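/- Conventions: spaces, maps, homotopies and homotopy equivalences are pointed, and $[X,Z]$ is the set of pointed homotopy classes of maps $X\to Z$. An H-group is a homotopy associative H-space with a homotopy inverse. For an H-group $Y$ the powers $Y^r$ carry the coordinate-wise H-group structure, and $[X,Y]$, $[X,Y^r]$ are groups (written additively; abelian if $Y$ is homotopy commutative). For an integer $k\ge 0$, $\mathbb{k}:Y\to Y$ is the $k$-th power map $x\mapsto(\cdots((xx)x)\cdots)x$ (the constant map for $k=0$). The homotopy fibre of a map $h:X\to Z$ is the space $F^h$ of pairs $(x,\gamma)$ with $x\in X$ and $\gamma$ a path in $Z$ from the base point to $h(x)$. **Theorem 1.2.** Let $X$ be a pointed topological space, $Y$ a homotopy commutative H-group, $f:X\to Y$ a map and $r\ge 2$. Let $m$ be the order of $f$ in $[X,Y]$ if this order is finite, and $m=0$ otherwise. For $1\le i\le r$ let $f_i:X\to Y^r$ be the map whose $i$-th coordinate is $f$ and whose other coordinates are constant at the base point. 1. Let $k_1,\dots,k_r\in\mathbb Z$, let $g:X\to Y^r$ be a map representing $\sum_{i=1}^r k_if_i\in\langle f_1,\dots,f_r\rangle\le[X,Y^r]$, and let $k=\gcd(m,k_1,\dots,k_r)$.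 Then there is a homotopy equivalence $$F^g\simeq F^{\mathbb{k}f}\times\prod_{i=1}^{r-1}\Omega Y,$$ where $F^{\mathbb{k}f}$ is the homotopy fibre of the composite $X\xrightarrow{f}Y\xrightarrow{\mathbb{k}}Y$. 2. In particular, if $f$ has finite order and $g,g':X\to Y^r$ are maps whose classes lie in $\langle f_1,\dots,f_r\rangle$ and have the same order, then $F^g\simeq F^{g'}$. -/

import Mathlib

namespace PtdHtpy

open scoped unitInterval

universe u v w

/-! ### Pointed maps and pointed homotopy classes -/

section Pointed

variable {X : Type u} {Y : Type v} {Z : Type w}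
  [TopologicalSpace X] [TopologicalSpace Y] [TopologicalSpace Z]

/-- Pointed (continuous) maps `(X, x₀) → (Y, y₀)`. -/
abbrev PMap (x₀ : X) (y₀ : Y) : Type (max u v) := {f : C(X, Y) // f x₀ = y₀}

/-- The composite of pointed maps. -/
def PMap.comp {x₀ : X} {y₀ : Y} {z₀ : Z} (g : PMap y₀ z₀) (f : PMap x₀ y₀) : PMap x₀ z₀ :=
  ⟨g.1.comp f.1, by simp [f.2, g.2]⟩

/-- The identity as a pointed map. -/
def PMap.id (x₀ : X) : PMap x₀ x₀ := ⟨ContinuousMap.id X, rfl⟩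

/-- Pointed homotopy of pointed maps: homotopy relative to the base point. -/
def PMap.Homotopic {x₀ : X} {y₀ : Y} (f g : PMap x₀ y₀) : Prop :=
  f.1.HomotopicRel g.1 {x₀}

/-- Pointed homotopy is an equivalence relation. -/
instance PMap.setoid (x₀ : X) (y₀ : Y) : Setoid (PMap x₀ y₀) where
  r := PMap.Homotopic
  iseqv := ⟨fun f => ContinuousMap.HomotopicRel.refl f.1,
    fun h => ContinuousMap.HomotopicRel.symm h,
    fun h h' => ContinuousMap.HomotopicRel.trans h h'⟩

/-- The set `[X, Y]` of pointed homotopy classes of pointed maps `(X, x₀) → (Y, y₀)`. -/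
def HClass (x₀ : X) (y₀ : Y) : Type (max u v) := Quotient (PMap.setoid x₀ y₀)

/-- The pointed homotopy class of a pointed map. -/
def PMap.cls {x₀ : X} {y₀ : Y} (f : PMap x₀ y₀) : HClass x₀ y₀ := Quotient.mk _ f

/-- `(X, x₀)` and `(Y, y₀)` are homotopy equivalent as pointed spaces: there are pointed maps in
both directions whose two composites are pointed homotopic to the identities. -/
def PtdHomotopyEquivalent (x₀ : X) (y₀ : Y) : Prop :=
  ∃ (φ : PMap x₀ y₀) (ψ : PMap y₀ x₀),
    (ψ.comp φ).Homotopic (PMap.id x₀) ∧ (φ.comp ψ).Homotopic (PMap.id y₀)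

/-- The homotopy fibre of a pointed map `g : (X, x₀) → (Y, y₀)`: the space of pairs `(x, γ)` with
`x` a point of `X` and `γ` a path in `Y` from `y₀` to `g x`, topologised as a subspace of
`X × C(I, Y)` (with the compact-open topology on paths). -/
abbrev HFibre {x₀ : X} {y₀ : Y} (g : PMap x₀ y₀) : Type (max u v) :=
  {p : X × C(I, Y) // p.2 0 = y₀ ∧ p.2 1 = g.1 p.1}

/-- The base point of the homotopy fibre: the base point of `X` with the constant path. -/
def HFibre.pt {x₀ : X} {y₀ : Y} (g : PMap x₀ y₀) : HFibre g :=
  ⟨(x₀, ContinuousMap.const I y₀), rfl, g.2.symm⟩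

end Pointed

/-! ### H-groups -/

/-- An H-group: an H-space (Mathlib's `HSpace`, whose base point is `HSpace.e`) which is homotopy
associative and has a homotopy inverse. All maps and all homotopies are pointed. -/
class HGroup (Y : Type v) [TopologicalSpace Y] extends HSpace Y where
  /-- `(x y) z ≃ x (y z)` -/
  assoc : ContinuousMap.HomotopicRel
    (hmul.comp ((hmul.comp
      ((ContinuousMap.fst (α := Y) (β := Y × Y)).prodMk
        ((ContinuousMap.fst (α := Y) (β := Y)).comp ContinuousMap.snd))).prodMk
          ((ContinuousMap.snd (α := Y) (β := Y)).comp ContinuousMap.snd)))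
    (hmul.comp ((ContinuousMap.fst (α := Y) (β := Y × Y)).prodMk (hmul.comp ContinuousMap.snd)))
    {(e, (e, e))}
  /-- the homotopy inverse -/
  hinv : C(Y, Y)
  hinv_e : hinv e = e
  /-- `x⁻¹ x ≃ *` -/
  hinv_mul : ContinuousMap.HomotopicRel
    (hmul.comp (hinv.prodMk (ContinuousMap.id Y))) (ContinuousMap.const Y e) {e}
  /-- `x x⁻¹ ≃ *` -/
  mul_hinv : ContinuousMap.HomotopicRel
    (hmul.comp ((ContinuousMap.id Y).prodMk hinv)) (ContinuousMap.const Y e) {e}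

/-- The base point of an H-space. -/
abbrev base (Y : Type v) [TopologicalSpace Y] [HSpace Y] : Y := HSpace.e

/-- An H-space is homotopy commutative if `x y ≃ y x` by a pointed homotopy. -/
class HomotopyCommutative (Y : Type v) [TopologicalSpace Y] [HSpace Y] : Prop where
  comm : ContinuousMap.HomotopicRel
    ((HSpace.hmul (X := Y)).comp (ContinuousMap.snd.prodMk ContinuousMap.fst))
    (HSpace.hmul (X := Y)) {(base Y, base Y)}

/-- The `k`-th power map of an H-group, for `k ≥ 0`: it is `x ↦ (⋯((x x) x)⋯) x` for `k ≥ 1`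
(the composite of the `k`-fold diagonal and the `k`-fold multiplication), and the constant map to
the base point for `k = 0`. -/
def power (Y : Type v) [TopologicalSpace Y] [HSpace Y] : ℕ → PMap (base Y) (base Y)
  | 0 => ⟨ContinuousMap.const Y (base Y), rfl⟩
  | 1 => PMap.id (base Y)
  | k + 2 => ⟨HSpace.hmul.comp ((power Y (k + 1)).1.prodMk (ContinuousMap.id Y)), by
      have h := (power Y (k + 1)).2
      simp [h, HSpace.hmul_e_e]⟩

/-! ### The group `[X, Y]` for an H-group `Y` -/

section Group

variable {X : Type u} [TopologicalSpace X] {x₀ : X}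

/-- Precomposing a pointed homotopy with a map carrying base points to base points. -/
theorem homotopicRel_precomp {A : Type v} {B : Type w} [TopologicalSpace A] [TopologicalSpace B]
    {p q : C(A, B)} {a : A} (h : p.HomotopicRel q {a}) (u : C(X, A)) (hu : u x₀ = a) :
    (p.comp u).HomotopicRel (q.comp u) {x₀} := by
  obtain ⟨H⟩ := h
  refine ⟨⟨⟨⟨fun z => H (z.1, u z.2), by fun_prop⟩, fun x => ?_, fun x => ?_⟩, ?_⟩⟩
  · simp
  · simp
  · rintro t x rfl
    simpa using H.prop' t (u x) hu

variable {Y : Type v} [TopologicalSpace Y]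

/-- The pointed map `x ↦ f(x) g(x)`, that is `μ ∘ (f × g) ∘ Δ`. -/
def PMap.mul [HSpace Y] (f g : PMap x₀ (base Y)) : PMap x₀ (base Y) :=
  ⟨HSpace.hmul.comp (f.1.prodMk g.1), by simp [f.2, g.2, HSpace.hmul_e_e]⟩

/-- The pointed map `x ↦ f(x)⁻¹`. -/
def PMap.inv [HGroup Y] (f : PMap x₀ (base Y)) : PMap x₀ (base Y) :=
  ⟨HGroup.hinv.comp f.1, by simp [f.2, HGroup.hinv_e]⟩

/-- The constant pointed map. -/
def PMap.const (x₀ : X) (y₀ : Y) : PMap x₀ y₀ := ⟨ContinuousMap.const X y₀, rfl⟩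

instance [HSpace Y] : Add (HClass x₀ (base Y)) where
  add := Quotient.map₂ PMap.mul fun _ _ h _ _ h' => by
    obtain ⟨H⟩ := h
    obtain ⟨H'⟩ := h'
    exact ContinuousMap.HomotopicRel.comp_continuousMap ⟨H.prod H'⟩ HSpace.hmul

instance [HSpace Y] : Zero (HClass x₀ (base Y)) where
  zero := (PMap.const x₀ (base Y)).cls

instance [HGroup Y] : Neg (HClass x₀ (base Y)) where
  neg := Quotient.map PMap.inv fun _ _ h =>
    ContinuousMap.HomotopicRel.comp_continuousMap h HGroup.hinv

/-- The group structure on `[X, Y]` induced by the H-group structure of `Y` (not necessarily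
commutative, written additively). -/
instance [HGroup Y] : AddGroup (HClass x₀ (base Y)) :=
  AddGroup.ofLeftAxioms
    (by
      rintro ⟨f⟩ ⟨g⟩ ⟨h⟩
      exact Quotient.sound (homotopicRel_precomp (x₀ := x₀) (HGroup.assoc (Y := Y))
        (f.1.prodMk (g.1.prodMk h.1)) (by simp [f.2, g.2, h.2])))
    (by
      rintro ⟨f⟩
      exact Quotient.sound (homotopicRel_precomp (x₀ := x₀) ⟨HSpace.eHmul (X := Y)⟩ f.1 f.2))
    (by
      rintro ⟨f⟩
      exact Quotient.sound (homotopicRel_precomp (x₀ := x₀) (HGroup.hinv_mul (Y := Y)) f.1 f.2))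

/-- The group `[X, Y]` is abelian when `Y` is homotopy commutative. -/
instance [HGroup Y] [HomotopyCommutative Y] : AddCommGroup (HClass x₀ (base Y)) where
  add_comm := by
    rintro ⟨f⟩ ⟨g⟩
    exact Quotient.sound (homotopicRel_precomp (x₀ := x₀) (HomotopyCommutative.comm (Y := Y))
      (g.1.prodMk f.1) (by simp [f.2, g.2]))

end Group

/-! ### Powers of H-groups, with the coordinate-wise structure -/

section Pi

variable {ι : Type u} {Y : Type v} [TopologicalSpace Y]

/-- Coordinate-wise pointed homotopies give a pointed homotopy of maps to a power. -/
theorem homotopicRel_pi {A : Type w} [TopologicalSpace A] {f g : C(A, ι → Y)} {S : Set A}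
    (h : ∀ i, ContinuousMap.HomotopicRel ((ContinuousMap.eval i).comp f)
      ((ContinuousMap.eval i).comp g) S) : f.HomotopicRel g S := by
  exact ⟨ContinuousMap.HomotopyRel.pi fun i => (h i).some⟩

/-- The `i`-th coordinate of a pair of points of a power. -/
def evalPair (i : ι) : C((ι → Y) × (ι → Y), Y × Y) :=
  ⟨fun p => (p.1 i, p.2 i), by fun_prop⟩

instance [HSpace Y] : HSpace (ι → Y) where
  hmul := ContinuousMap.pi fun i => HSpace.hmul.comp (evalPair i)
  e := fun _ => base Y
  hmul_e_e := funext fun _ => HSpace.hmul_e_e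
  eHmul :=
    { toFun := fun p i => HSpace.eHmul (X := Y) (p.1, p.2 i)
      continuous_toFun := by fun_prop
      map_zero_left := fun x => funext fun i => HSpace.eHmul.1.2 (x i)
      map_one_left := fun x => funext fun i => HSpace.eHmul.1.3 (x i)
      prop' := fun t x hx => funext fun i => HSpace.eHmul.2 t (x i) (congrFun hx i) }
  hmulE :=
    { toFun := fun p i => HSpace.hmulE (X := Y) (p.1, p.2 i)
      continuous_toFun := by fun_prop
      map_zero_left := fun x => funext fun i => HSpace.hmulE.1.2 (x i)
      map_one_left := fun x => funext fun i => HSpace.hmulE.1.3 (x i)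
      prop' := fun t x hx => funext fun i => HSpace.hmulE.2 t (x i) (congrFun hx i) }

instance [HGroup Y] : HGroup (ι → Y) where
  toHSpace := inferInstance
  assoc := homotopicRel_pi fun i =>
    homotopicRel_precomp (HGroup.assoc (Y := Y))
      (⟨fun p => (p.1 i, (p.2.1 i, p.2.2 i)), by fun_prop⟩ :
        C((ι → Y) × (ι → Y) × (ι → Y), Y × Y × Y)) rfl
  hinv := ContinuousMap.pi fun i => HGroup.hinv.comp (ContinuousMap.eval i)
  hinv_e := funext fun _ => HGroup.hinv_e
  hinv_mul := homotopicRel_pi fun i =>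
    homotopicRel_precomp (HGroup.hinv_mul (Y := Y)) (⟨fun p => p i, by fun_prop⟩ : C(ι → Y, Y)) rfl
  mul_hinv := homotopicRel_pi fun i =>
    homotopicRel_precomp (HGroup.mul_hinv (Y := Y)) (⟨fun p => p i, by fun_prop⟩ : C(ι → Y, Y)) rfl

instance [HGroup Y] [HomotopyCommutative Y] : HomotopyCommutative (ι → Y) where
  comm := homotopicRel_pi fun i =>
    homotopicRel_precomp (HomotopyCommutative.comm (Y := Y)) (evalPair i) rfl

/-- For `f : X → Y`, the map `f_i : X → Y^ι` whose `i`-th coordinate is `f` and whose other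
coordinates are constant at the base point. -/
def axis [DecidableEq ι] [HSpace Y] {X : Type w} [TopologicalSpace X] {x₀ : X}
    (f : PMap x₀ (base Y)) (i : ι) : PMap x₀ (base (ι → Y)) :=
  ⟨ContinuousMap.pi fun j => if j = i then f.1 else ContinuousMap.const X (base Y), by
    funext j
    change (if j = i then f.1 else ContinuousMap.const X (base Y)) x₀ = base Y
    split_ifs
    · exact f.2
    · rfl⟩

end Pi

end PtdHtpy

open PtdHtpy

namespace PtdHtpy

open scoped unitInterval

universe u v w

/-! ### Homotopy invariance of the homotopy fibre -/

section Fibres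

variable {W : Type*} {X : Type u} {Y : Type v} {Z : Type w}
  [TopologicalSpace W] [TopologicalSpace X] [TopologicalSpace Y] [TopologicalSpace Z]

/-! Up to pointed equivalence, the homotopy fibre of `g` does not change when `g` is replaced by a
homotopic map (`HFibre.equivalent_of_homotopic`) or composed with a self-equivalence of the target
(`HFibre.equivalent_comp`). Integer matrices act on the coordinates of a power of `Y`: the homotopy
inverse of `Y` provides negative entries, and homotopy commutativity makes composition of such maps
correspond to the matrix product. A matrix of determinant one in two coordinates therefore gives a
self-equivalence of the power (`HFibre.equivalent_of_det_eq_one`).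

If the coordinates of `g` are the multiples `k i • f`, Euclid's algorithm, carried out by such
matrices, moves the gcd of the `k i` into one coordinate and makes the others null-homotopic. Since
`m • f = 0` for the order `m` of `f`, a cleared coordinate `0` can be reread as `m • f`; one more
Euclidean step replaces the gcd by its gcd `d` with `m`. Having at least two coordinates leaves room
for this. The resulting map is concentrated on one axis, and there the fibre visibly splits as the
fibre of `d • f` times a loop space for each remaining coordinate.

When `m` is finite and nonzero, the class of `g` has order `m / d` (`addOrderOf_sum_axis`), so the
order determines `d` and hence the fibre. -/

theorem PMap.homotopic_of_continuous {x₀ : X} {y₀ : Y} {f g : PMap x₀ y₀} (H : I × X → Y)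
    (hH : Continuous H) (h₀ : ∀ x, H (0, x) = f.1 x) (h₁ : ∀ x, H (1, x) = g.1 x)
    (hb : ∀ t, H (t, x₀) = y₀) : f.Homotopic g := by
  refine ⟨⟨⟨⟨H, hH⟩, h₀, h₁⟩, ?_⟩⟩
  rintro t x rfl
  exact (hb t).trans f.2.symm

theorem PMap.Homotopic.exists_continuous {x₀ : X} {y₀ : Y} {f g : PMap x₀ y₀}
    (h : f.Homotopic g) : ∃ H : C(I × X, Y), (∀ x, H (0, x) = f.1 x) ∧ (∀ x, H (1, x) = g.1 x) ∧
      ∀ t, H (t, x₀) = y₀ := by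
  obtain ⟨H⟩ := h
  exact ⟨H.toContinuousMap, H.apply_zero, H.apply_one, fun t => (H.eq_fst t rfl).trans f.2⟩

theorem PMap.Homotopic.comp {x₀ : X} {y₀ : Y} {z₀ : Z} {g g' : PMap y₀ z₀} {f f' : PMap x₀ y₀}
    (hg : g.Homotopic g') (hf : f.Homotopic f') : (g.comp f).Homotopic (g'.comp f') :=
  (ContinuousMap.HomotopicRel.comp_continuousMap hf g.1).trans (homotopicRel_precomp hg f'.1 f'.2)

theorem PMap.Homotopic.symm {x₀ : X} {y₀ : Y} {f g : PMap x₀ y₀} (h : f.Homotopic g) :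
    g.Homotopic f := ContinuousMap.HomotopicRel.symm h

theorem PMap.Homotopic.trans {x₀ : X} {y₀ : Y} {f g h : PMap x₀ y₀} (h₁ : f.Homotopic g)
    (h₂ : g.Homotopic h) : f.Homotopic h := ContinuousMap.HomotopicRel.trans h₁ h₂

theorem PMap.Homotopic.refl {x₀ : X} {y₀ : Y} (f : PMap x₀ y₀) : f.Homotopic f :=
  ContinuousMap.HomotopicRel.refl f.1

theorem PtdHomotopyEquivalent.symm {x₀ : X} {y₀ : Y} (h : PtdHomotopyEquivalent x₀ y₀) :
    PtdHomotopyEquivalent y₀ x₀ := by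
  obtain ⟨φ, ψ, h₁, h₂⟩ := h
  exact ⟨ψ, φ, h₂, h₁⟩

theorem PtdHomotopyEquivalent.refl (x₀ : X) : PtdHomotopyEquivalent x₀ x₀ :=
  ⟨PMap.id x₀, PMap.id x₀, .refl _, .refl _⟩

theorem PtdHomotopyEquivalent.trans {x₀ : X} {y₀ : Y} {z₀ : Z}
    (h : PtdHomotopyEquivalent x₀ y₀) (h' : PtdHomotopyEquivalent y₀ z₀) :
    PtdHomotopyEquivalent x₀ z₀ := by
  obtain ⟨φ, ψ, h₁, h₂⟩ := h
  obtain ⟨φ', ψ', h₁', h₂'⟩ := h'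
  refine ⟨φ'.comp φ, ψ.comp ψ', ?_, ?_⟩
  · exact (((PMap.Homotopic.refl ψ).comp h₁').comp (.refl φ)).trans h₁
  · exact (((PMap.Homotopic.refl φ').comp h₂).comp (.refl ψ')).trans h₂'

theorem PtdHomotopyEquivalent.of_homeomorph {x₀ : X} {y₀ : Y} (e : X ≃ₜ Y) (h : e x₀ = y₀) :
    PtdHomotopyEquivalent x₀ y₀ := by
  refine ⟨⟨⟨e, e.continuous⟩, h⟩, ⟨⟨e.symm, e.symm.continuous⟩, ?_⟩, ?_, ?_⟩
  · simp [← h]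
  · exact PMap.homotopic_of_continuous (fun p => p.2) (by fun_prop)
      (fun x => (e.symm_apply_apply x).symm) (fun _ => rfl) (fun _ => rfl)
  · exact PMap.homotopic_of_continuous (fun p => p.2) (by fun_prop)
      (fun x => (e.apply_symm_apply x).symm) (fun _ => rfl) (fun _ => rfl)

/-- The middle map of three composable maps is an equivalence if both binary composites are. -/
theorem PtdHomotopyEquivalent.of_two_out_of_six {w₀ : W} {x₀ : X} {y₀ : Y} {z₀ : Z}
    {a : PMap w₀ x₀} {b : PMap x₀ y₀} {c : PMap y₀ z₀} {p : PMap y₀ w₀} {q : PMap z₀ x₀}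
    (hp : ((b.comp a).comp p).Homotopic (PMap.id y₀))
    (hq : (q.comp (c.comp b)).Homotopic (PMap.id x₀)) : PtdHomotopyEquivalent x₀ y₀ := by
  refine ⟨b, a.comp p, ?_, hp⟩
  -- `b` has the right inverse `a p` and the left inverse `q c`; inserting the latter in front and
  -- cancelling `b a p` shows that `a p` is a left inverse too.
  have h₁ : ((a.comp p).comp b).Homotopic ((q.comp (c.comp b)).comp ((a.comp p).comp b)) :=
    hq.symm.comp (.refl ((a.comp p).comp b))
  have h₂ : (((q.comp c).comp ((b.comp a).comp p)).comp b).Homotopic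
      (((q.comp c).comp (PMap.id y₀)).comp b) :=
    (PMap.Homotopic.comp (.refl _) hp).comp (.refl _)
  exact h₁.trans (h₂.trans hq)

/-- A map to the homotopy fibre of `g`, from a map to `X` and a family of paths. -/
def HFibre.lift {x₀ : X} {z₀ : Z} (g : PMap x₀ z₀) (a : C(W, X)) (p : C(W × I, Z))
    (h₀ : ∀ w, p (w, 0) = z₀) (h₁ : ∀ w, p (w, 1) = g.1 (a w)) : C(W, HFibre g) :=
  ⟨fun w => ⟨(a w, p.curry w), h₀ w, h₁ w⟩, by fun_prop⟩

/-- The homotopy fibre is natural in the target. -/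
def HFibre.map {x₀ : X} {y₀ : Y} {z₀ : Z} (φ : PMap y₀ z₀) (g : PMap x₀ y₀) :
    PMap (HFibre.pt g) (HFibre.pt (φ.comp g)) :=
  ⟨HFibre.lift (φ.comp g) ⟨fun q => q.1.1, by fun_prop⟩ ⟨fun q => φ.1 (q.1.1.2 q.2), by fun_prop⟩
    (fun q => by simp [q.2.1, φ.2]) (fun q => by simp [q.2.2, PMap.comp]), by
    refine Subtype.ext (Prod.ext rfl ?_)
    ext t
    exact φ.2⟩

/-- Truncation of a real number to the unit interval. -/
noncomputable abbrev clampI (t : ℝ) : I := Set.projIcc 0 1 zero_le_one t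

theorem clampI_of_nonpos {t : ℝ} (h : t ≤ 0) : clampI t = 0 := Set.projIcc_of_le_left _ h

theorem clampI_of_one_le {t : ℝ} (h : 1 ≤ t) : clampI t = 1 := Set.projIcc_of_right_le _ h

theorem clampI_coe (t : I) : clampI (t : ℝ) = t := Set.projIcc_val _ t

theorem clampI_one_sub (t : ℝ) : clampI (1 - t) = σ (clampI t) := by
  rcases le_total t 0 with h | h
  · rw [clampI_of_nonpos h, clampI_of_one_le (by linarith), unitInterval.symm_zero]
  rcases le_total 1 t with h' | h'
  · rw [clampI_of_one_le h', clampI_of_nonpos (by linarith), unitInterval.symm_one]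
  have h₁ : clampI (1 - t) = ⟨1 - t, by linarith, by linarith⟩ :=
    Set.projIcc_of_mem _ ⟨by linarith, by linarith⟩
  have h₂ : clampI t = ⟨t, h, h'⟩ := Set.projIcc_of_mem _ ⟨h, h'⟩
  rw [h₁, h₂]
  rfl

theorem continuous_clampI : Continuous clampI := continuous_projIcc

attribute [fun_prop] continuous_clampI

/-- Concatenating a path `γ` ending at `H 0 x` with the track of `x` under a homotopy `H`: the
former is run through on `[0, 1]`, and then the time parameter of the latter is `s`. -/
theorem continuous_concat {x₀ : X} {z₀ : Z} {g : PMap x₀ z₀} (H : C(I × X, Z))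
    (h₀ : ∀ x, H (0, x) = g.1 x) {q : W → HFibre g} (hq : Continuous q) {τ s : W → ℝ}
    (hτ : Continuous τ) (hs : Continuous s) (hs₀ : ∀ w, τ w = 1 → s w ≤ 0) :
    Continuous fun w => if τ w ≤ 1 then (q w).1.2 (clampI (τ w)) else
      H (clampI (s w), (q w).1.1) := by
  refine Continuous.if_le (by fun_prop) (by fun_prop) hτ continuous_const fun w hw => ?_
  rw [hw, clampI_of_one_le le_rfl, clampI_of_nonpos (hs₀ w hw), h₀, (q w).2.2]

/-- The map of homotopy fibres induced by a pointed homotopy. -/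
noncomputable def HFibre.transport {x₀ : X} {z₀ : Z} {g g' : PMap x₀ z₀} (H : C(I × X, Z))
    (h₀ : ∀ x, H (0, x) = g.1 x) (h₁ : ∀ x, H (1, x) = g'.1 x) (hb : ∀ t, H (t, x₀) = z₀) :
    PMap (HFibre.pt g) (HFibre.pt g') :=
  ⟨HFibre.lift g' ⟨fun q => q.1.1, by fun_prop⟩
    ⟨fun q => if 2 * (q.2 : ℝ) ≤ 1 then q.1.1.2 (clampI (2 * q.2)) else
      H (clampI (2 * q.2 - 1), q.1.1.1),
      continuous_concat H h₀ (q := fun w : HFibre g × I => w.1) (by fun_prop)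
        (τ := fun w => 2 * (w.2 : ℝ)) (s := fun w => 2 * (w.2 : ℝ) - 1) (by fun_prop)
        (by fun_prop) (fun w hw => by simp [hw])⟩
    (fun q => by
      have : clampI (2 * ((0 : I) : ℝ)) = 0 := clampI_of_nonpos (by simp)
      simp only [ContinuousMap.coe_mk, this, q.2.1]
      simp)
    (fun q => by
      have : clampI (2 * ((1 : I) : ℝ) - 1) = 1 := clampI_of_one_le (by norm_num)
      simp only [ContinuousMap.coe_mk, this, h₁]
      norm_num), by
    refine Subtype.ext (Prod.ext rfl ?_)
    ext t
    change (if _ then z₀ else H (_, x₀)) = z₀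
    rw [hb, ite_self]⟩

theorem HFibre.transport_apply {x₀ : X} {z₀ : Z} {g g' : PMap x₀ z₀} (H : C(I × X, Z))
    (h₀ : ∀ x, H (0, x) = g.1 x) (h₁ : ∀ x, H (1, x) = g'.1 x) (hb : ∀ t, H (t, x₀) = z₀)
    (q : HFibre g) (t : I) :
    ((HFibre.transport H h₀ h₁ hb).1 q).1.2 t = if 2 * (t : ℝ) ≤ 1 then q.1.2 (clampI (2 * t)) else
      H (clampI (2 * t - 1), q.1.1) := rfl

/-- Transport along a homotopy, then back along its reverse, is homotopic to the identity. -/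
theorem HFibre.transport_comp_transport_symm {x₀ : X} {z₀ : Z} {g g' : PMap x₀ z₀}
    (H K : C(I × X, Z)) (h₀ : ∀ x, H (0, x) = g.1 x) (h₁ : ∀ x, H (1, x) = g'.1 x)
    (hb : ∀ t, H (t, x₀) = z₀) (k₀ : ∀ x, K (0, x) = g'.1 x) (k₁ : ∀ x, K (1, x) = g.1 x)
    (kb : ∀ t, K (t, x₀) = z₀) (hK : ∀ t x, K (t, x) = H (σ t, x)) :
    ((HFibre.transport K k₀ k₁ kb).comp (HFibre.transport H h₀ h₁ hb)).Homotopic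
      (PMap.id (HFibre.pt g)) := by
  -- `τ` is a clock and `s` the parameter of `H`. At stage `u` the clock runs from `0` to `3 - 2u`:
  -- the path `γ` occupies `[0, 1]`, after which `s` goes up to `1 - u` and back to `0`. At `u = 0`
  -- the speeds `4t` and `2t + 1` are those of the double transport; at `u = 1` one has `τ = t` and
  -- only `γ` is left.
  let τ : (I × HFibre g) × I → ℝ := fun w =>
    w.1.1 * w.2 + (1 - w.1.1) * min (4 * (w.2 : ℝ)) (2 * w.2 + 1)
  let s : (I × HFibre g) × I → ℝ := fun w => min (τ w - 1) (1 + 2 * (1 - w.1.1) - τ w)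
  have hτ : Continuous τ := by fun_prop
  have hs : Continuous s := by fun_prop
  have hc := continuous_concat H h₀ (q := fun w : (I × HFibre g) × I => w.1.2) (by fun_prop) hτ hs
    (fun w hw => by simp [s, hw])
  refine PMap.homotopic_of_continuous (HFibre.lift g ⟨fun w => w.2.1.1, by fun_prop⟩ ⟨_, hc⟩
    ?_ ?_) (ContinuousMap.continuous _) ?_ ?_ ?_
  · intro w
    have h : τ (w, 0) = 0 := by simp [τ]
    simp only [ContinuousMap.coe_mk, h, clampI_of_nonpos le_rfl, w.2.2.1]
    simp
  · intro w
    have h : τ (w, 1) = 1 + 2 * (1 - w.1) := by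
      have : min (4 * (1 : ℝ)) (2 * 1 + 1) = 3 := by norm_num
      simp only [τ, Set.Icc.coe_one, this]
      ring
    have h' : clampI (s (w, 1)) = 0 := by
      apply clampI_of_nonpos
      simp [s, h]
    simp only [ContinuousMap.coe_mk, h', h₀]
    split_ifs with hle
    · rw [clampI_of_one_le (by have := w.1.2.2; rw [h]; linarith), w.2.2.2]
    · rfl
  · intro q
    refine Subtype.ext (Prod.ext rfl ?_)
    ext t
    change (if τ ((0, q), t) ≤ 1 then q.1.2 (clampI (τ ((0, q), t))) else
      H (clampI (s ((0, q), t)), q.1.1)) = ((HFibre.transport K k₀ k₁ kb).1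
        ((HFibre.transport H h₀ h₁ hb).1 q)).1.2 t
    have hq : ((HFibre.transport H h₀ h₁ hb).1 q).1.1 = q.1.1 := rfl
    have hτ' : τ ((0, q), t) = min (4 * (t : ℝ)) (2 * t + 1) := by simp [τ]
    have hs' : s ((0, q), t) = min (τ ((0, q), t) - 1) (3 - τ ((0, q), t)) := by
      simp [s]; norm_num
    rw [HFibre.transport_apply, HFibre.transport_apply, hq, hK, ← clampI_one_sub, hs', hτ']
    have ht₀ := t.2.1
    have ht₁ := t.2.2
    by_cases ht : 2 * (t : ℝ) ≤ 1
    · have hc : ((clampI (2 * (t : ℝ)) : I) : ℝ) = 2 * t := by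
        rw [clampI, Set.projIcc_of_mem _ (⟨by linarith, ht⟩ : 2 * (t : ℝ) ∈ Set.Icc (0 : ℝ) 1)]
      rw [if_pos ht, hc, min_eq_left (by linarith), min_eq_left (by linarith),
        show 2 * (2 * (t : ℝ)) = 4 * t by ring]
    · push Not at ht
      rw [if_neg (not_le.2 ht), min_eq_right (by linarith), if_neg (by linarith),
        min_eq_right (by linarith)]
      congr 3
      ring
  · intro q
    refine Subtype.ext (Prod.ext rfl ?_)
    ext t
    change (if τ ((1, q), t) ≤ 1 then q.1.2 (clampI (τ ((1, q), t))) else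
      H (clampI (s ((1, q), t)), q.1.1)) = q.1.2 t
    have hτ' : τ ((1, q), t) = t := by simp [τ]
    rw [hτ', if_pos t.2.2, clampI_coe]
  · intro t
    refine Subtype.ext (Prod.ext rfl ?_)
    ext t'
    change (if _ then z₀ else H (_, x₀)) = z₀
    rw [hb, ite_self]

/-- The reverse of a homotopy. -/
def reverseHomotopy (H : C(I × X, Z)) : C(I × X, Z) := ⟨fun p => H (σ p.1, p.2), by fun_prop⟩

theorem HFibre.exists_transport {x₀ : X} {z₀ : Z} {g g' : PMap x₀ z₀} (H : C(I × X, Z))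
    (h₀ : ∀ x, H (0, x) = g.1 x) (h₁ : ∀ x, H (1, x) = g'.1 x) (hb : ∀ t, H (t, x₀) = z₀) :
    ∃ T : PMap (HFibre.pt g') (HFibre.pt g),
      (T.comp (HFibre.transport H h₀ h₁ hb)).Homotopic (PMap.id _) ∧
      ((HFibre.transport H h₀ h₁ hb).comp T).Homotopic (PMap.id _) := by
  refine ⟨HFibre.transport (reverseHomotopy H) (fun x => ?_) (fun x => ?_) fun t => hb _,
    HFibre.transport_comp_transport_symm _ _ _ _ _ _ _ _ fun _ _ => rfl,
    HFibre.transport_comp_transport_symm _ _ _ _ _ _ _ _ fun t x => ?_⟩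
  · simp [reverseHomotopy, h₁]
  · simp [reverseHomotopy, h₀]
  · simp [reverseHomotopy]

/-- Homotopic maps have equivalent homotopy fibres. -/
theorem HFibre.equivalent_of_homotopic {x₀ : X} {z₀ : Z} {g g' : PMap x₀ z₀}
    (h : g.Homotopic g') : PtdHomotopyEquivalent (HFibre.pt g) (HFibre.pt g') := by
  obtain ⟨H, h₀, h₁, hb⟩ := h.exists_continuous
  obtain ⟨T, hT, hT'⟩ := HFibre.exists_transport H h₀ h₁ hb
  exact ⟨_, T, hT, hT'⟩

/-- Up to transport, a self-map of the target which is homotopic to the identity induces the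
identity of the homotopy fibre. -/
theorem HFibre.transport_comp_map {x₀ : X} {z₀ : Z} {g : PMap x₀ z₀} {φ : PMap z₀ z₀}
    (K : C(I × Z, Z)) (k₀ : ∀ z, K (0, z) = φ.1 z) (k₁ : ∀ z, K (1, z) = z)
    (kb : ∀ t, K (t, z₀) = z₀) :
    ((HFibre.transport (g := φ.comp g) (g' := g) (K.comp ((ContinuousMap.id I).prodMap g.1))
      (fun x => k₀ (g.1 x)) (fun x => k₁ (g.1 x))
      (fun t => (congrArg (fun z => K (t, z)) g.2).trans (kb t))).comp
      (HFibre.map φ g)).Homotopic (PMap.id (HFibre.pt g)) := by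
  -- In the square of pairs (time of `K`, time of `γ`), the path at stage `u` goes from `(u, 0)` to
  -- `(u, 1)` at speed `2 - u` and then to `(1, 1)`. For `u = 0` this is `φ ∘ γ` followed by the
  -- track of its endpoint; for `u = 1` it is `γ` itself. The ends stay at `z₀` and `g x`
  -- throughout.
  refine PMap.homotopic_of_continuous (HFibre.lift g ⟨fun w => w.2.1.1, by fun_prop⟩
    ⟨fun w => K (clampI ((w.1.1 : ℝ) + max ((2 - (w.1.1 : ℝ)) * w.2 - 1) 0),
      w.1.2.1.2 (clampI ((2 - (w.1.1 : ℝ)) * w.2))), by fun_prop⟩ ?_ ?_)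
      (ContinuousMap.continuous _) ?_ ?_ ?_
  · intro w
    have h : clampI ((2 - (w.1 : ℝ)) * ((0 : I) : ℝ)) = 0 := clampI_of_nonpos (by simp)
    simp only [ContinuousMap.coe_mk, h, w.2.2.1, kb]
  · intro w
    have hw := w.1.2.2
    have h : clampI ((2 - (w.1 : ℝ)) * ((1 : I) : ℝ)) = 1 :=
      clampI_of_one_le (by simp; linarith)
    have h' : clampI ((w.1 : ℝ) + max ((2 - (w.1 : ℝ)) * ((1 : I) : ℝ) - 1) 0) = 1 := by
      apply clampI_of_one_le
      have := le_max_left ((2 - (w.1 : ℝ)) * ((1 : I) : ℝ) - 1) 0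
      simp only [Set.Icc.coe_one] at this ⊢
      linarith
    simp only [ContinuousMap.coe_mk, h, h', w.2.2.2, k₁]
  · intro q
    refine Subtype.ext (Prod.ext rfl ?_)
    ext t
    change K (clampI (((0 : I) : ℝ) + max ((2 - ((0 : I) : ℝ)) * t - 1) 0),
      q.1.2 (clampI ((2 - ((0 : I) : ℝ)) * t))) =
        if 2 * (t : ℝ) ≤ 1 then φ.1 (q.1.2 (clampI (2 * t))) else
          K (clampI (2 * t - 1), g.1 q.1.1)
    simp only [Set.Icc.coe_zero, sub_zero, zero_add]
    split_ifs with ht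
    · rw [max_eq_right (by linarith), clampI_of_nonpos le_rfl, k₀]
    · push Not at ht
      rw [max_eq_left (by linarith), clampI_of_one_le ht.le, q.2.2]
  · intro q
    refine Subtype.ext (Prod.ext rfl ?_)
    ext t
    change K (clampI (((1 : I) : ℝ) + max ((2 - ((1 : I) : ℝ)) * t - 1) 0),
      q.1.2 (clampI ((2 - ((1 : I) : ℝ)) * t))) = q.1.2 t
    have h : (2 - ((1 : I) : ℝ)) * t = t := by
      rw [Set.Icc.coe_one]
      ring
    rw [h, clampI_coe, clampI_of_one_le (by simp), k₁]
  · intro t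
    refine Subtype.ext (Prod.ext rfl ?_)
    ext t'
    exact kb _

/-- Composition with an equivalence does not change the homotopy fibre. -/
theorem HFibre.equivalent_comp {x₀ : X} {y₀ : Y} {z₀ : Z} (g : PMap x₀ y₀) {φ : PMap y₀ z₀}
    {ψ : PMap z₀ y₀} (h : (ψ.comp φ).Homotopic (PMap.id y₀))
    (h' : (φ.comp ψ).Homotopic (PMap.id z₀)) :
    PtdHomotopyEquivalent (HFibre.pt g) (HFibre.pt (φ.comp g)) := by
  obtain ⟨K, k₀, k₁, kb⟩ := h.exists_continuous
  obtain ⟨K', k₀', k₁', kb'⟩ := h'.exists_continuous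
  have hK := HFibre.transport_comp_map (g := g) K k₀ k₁ kb
  obtain ⟨T, hT, -⟩ := HFibre.exists_transport (g := (ψ.comp φ).comp g) (g' := g)
    (K.comp ((ContinuousMap.id I).prodMap g.1)) (fun x => k₀ (g.1 x)) (fun x => k₁ (g.1 x))
    (fun t => (congrArg (fun z => K (t, z)) g.2).trans (kb t))
  have hK' := HFibre.transport_comp_map (g := φ.comp g) K' k₀' k₁' kb'
  set S := HFibre.transport (g := (ψ.comp φ).comp g) (g' := g)
    (K.comp ((ContinuousMap.id I).prodMap g.1)) (fun x => k₀ (g.1 x)) (fun x => k₁ (g.1 x))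
    (fun t => (congrArg (fun z => K (t, z)) g.2).trans (kb t))
  -- `hK` makes the induced map a right inverse of `S`; since `S` also has the left inverse `T`, the
  -- two agree up to homotopy, and the induced map is a left inverse as well.
  have hS : ((HFibre.map (ψ.comp φ) g).comp S).Homotopic (PMap.id _) := by
    have e₁ : ((HFibre.map (ψ.comp φ) g).comp S).Homotopic
        ((T.comp S).comp ((HFibre.map (ψ.comp φ) g).comp S)) :=
      hT.symm.comp (.refl ((HFibre.map (ψ.comp φ) g).comp S))
    have e₂ : ((T.comp (S.comp (HFibre.map (ψ.comp φ) g))).comp S).Homotopic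
        ((T.comp (PMap.id _)).comp S) := (PMap.Homotopic.comp (.refl T) hK).comp (.refl S)
    exact e₁.trans (e₂.trans hT)
  -- The comparison passes through the fibre of `ψ ∘ φ ∘ g`: it agrees with that of `g` by homotopy,
  -- and with that of `φ ∘ g` by the map induced by `ψ`, the middle one of the maps induced by `φ`,
  -- `ψ`, `φ`.
  exact (equivalent_of_homotopic (h.symm.comp (.refl g))).trans
    (PtdHomotopyEquivalent.of_two_out_of_six (a := HFibre.map φ g)
      (b := HFibre.map ψ (φ.comp g)) (c := HFibre.map φ (ψ.comp (φ.comp g))) hS hK').symm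

end Fibres

/-! ### Splitting the fibre of a map into one axis -/

section Splitting

variable {X : Type u} {Y : Type v} [TopologicalSpace X] [TopologicalSpace Y] [HSpace Y] {x₀ : X}

/-- The homotopy fibre of a map into one axis of a power splits. -/
def HFibre.axisHomeomorph (h : PMap x₀ (base Y)) (n : ℕ) :
    HFibre (axis (ι := Fin (n + 1)) h 0) ≃ₜ HFibre h × (Fin n → LoopSpace Y (base Y)) where
  -- A path in the power from the base point to `(h x, *, …, *)` is a path to `h x` together with
  -- `n` loops, which do not involve `x`.
  toFun q := (⟨(q.1.1, (ContinuousMap.eval 0).comp q.1.2), congrFun q.2.1 0, congrFun q.2.2 0⟩,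
    fun i => ⟨(ContinuousMap.eval i.succ).comp q.1.2, congrFun q.2.1 i.succ, congrFun q.2.2 i.succ⟩)
  invFun q := ⟨(q.1.1.1, ContinuousMap.pi (Fin.cons q.1.1.2 fun i => (q.2 i).toContinuousMap)), by
    funext j
    refine Fin.cases ?_ (fun i => ?_) j
    · exact q.1.2.1
    · exact (q.2 i).source, by
    funext j
    refine Fin.cases ?_ (fun i => ?_) j
    · exact q.1.2.2
    · exact (q.2 i).target⟩
  left_inv q := by
    refine Subtype.ext (Prod.ext rfl ?_)
    ext t j
    refine Fin.cases ?_ (fun i => ?_) j <;> rfl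
  right_inv q := rfl
  continuous_toFun := by
    refine Continuous.prodMk (by fun_prop) (continuous_pi fun i => ?_)
    exact continuous_induced_rng.2
      (by fun_prop : Continuous fun q : HFibre (axis (ι := Fin (n + 1)) h 0) =>
        (ContinuousMap.eval i.succ).comp q.1.2)
  continuous_invFun := by
    refine Continuous.subtype_mk (Continuous.prodMk (by fun_prop) ?_) _
    refine ContinuousMap.continuous_of_continuous_uncurry _ (continuous_pi fun j => ?_)
    refine Fin.cases ?_ (fun i => ?_) j
    · exact (by fun_prop : Continuous fun p : (HFibre h × (Fin n → LoopSpace Y (base Y))) × I =>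
        p.1.1.1.2 p.2)
    · exact (by fun_prop : Continuous fun p : (HFibre h × (Fin n → LoopSpace Y (base Y))) × I =>
        p.1.2 i p.2)

theorem HFibre.equivalent_axis (h : PMap x₀ (base Y)) (n : ℕ) :
    PtdHomotopyEquivalent (HFibre.pt (axis (ι := Fin (n + 1)) h 0))
      ((HFibre.pt h, fun _ => Path.refl (base Y)) :
        HFibre h × (Fin n → LoopSpace Y (base Y))) :=
  PtdHomotopyEquivalent.of_homeomorph (HFibre.axisHomeomorph h n) rfl

end Splitting

/-! ### Integer matrices acting on a power of an H-group -/

section Coordinates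

variable {W : Type*} {X : Type u} {Y : Type v} {ι : Type w} [TopologicalSpace W]
  [TopologicalSpace X] [TopologicalSpace Y] {w₀ : W} {x₀ : X}

theorem PMap.cls_eq_iff {y₀ : Y} {f g : PMap x₀ y₀} : f.cls = g.cls ↔ f.Homotopic g :=
  Quotient.eq (r := PMap.setoid x₀ y₀)

theorem PMap.exists_cls_eq {y₀ : Y} (a : HClass x₀ y₀) : ∃ f : PMap x₀ y₀, f.cls = a :=
  Quotient.exists_rep a

/-- Precomposition with a pointed map, as a homomorphism. -/
def HClass.precomp [HGroup Y] (u : PMap w₀ x₀) :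
    HClass x₀ (base Y) →+ HClass w₀ (base Y) :=
  AddMonoidHom.mk' (Quotient.map (fun f => f.comp u) fun _ _ h => h.comp (.refl u)) (by
    rintro ⟨f⟩ ⟨g⟩
    rfl)

/-- The `i`-th projection of a power. -/
def coordMap [HSpace Y] (i : ι) : PMap (base (ι → Y)) (base Y) := ⟨ContinuousMap.eval i, rfl⟩

/-- The `i`-th coordinate of a class of maps to a power, as a homomorphism. -/
def HClass.coord [HGroup Y] (i : ι) : HClass x₀ (base (ι → Y)) →+ HClass x₀ (base Y) :=
  AddMonoidHom.mk' (Quotient.map (fun f => (coordMap i).comp f) fun _ _ h =>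
    PMap.Homotopic.comp (.refl (coordMap i)) h) (by
    rintro ⟨f⟩ ⟨g⟩
    rfl)

theorem HClass.coord_cls [HGroup Y] (i : ι) (g : PMap x₀ (base (ι → Y))) :
    HClass.coord i g.cls = ((coordMap i).comp g).cls := rfl

theorem HClass.coord_ext [HGroup Y] {a b : HClass x₀ (base (ι → Y))}
    (h : ∀ i, HClass.coord i a = HClass.coord i b) : a = b := by
  obtain ⟨f, rfl⟩ := PMap.exists_cls_eq a
  obtain ⟨g, rfl⟩ := PMap.exists_cls_eq b
  exact PMap.cls_eq_iff.2 (homotopicRel_pi fun i => PMap.cls_eq_iff.1 (h i))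

theorem exists_coord_eq [HGroup Y] (a : ι → HClass x₀ (base Y)) :
    ∃ g : PMap x₀ (base (ι → Y)), ∀ i, HClass.coord i g.cls = a i := by
  choose f hf using fun i => PMap.exists_cls_eq (a i)
  exact ⟨⟨ContinuousMap.pi fun i => (f i).1, funext fun i => (f i).2⟩, hf⟩

theorem coord_axis [DecidableEq ι] [HGroup Y] (f : PMap x₀ (base Y)) (i j : ι) :
    HClass.coord j (axis f i).cls = if j = i then f.cls else 0 := by
  have : (coordMap j).comp (axis f i) = if j = i then f else PMap.const x₀ (base Y) := by
    refine Subtype.ext (ContinuousMap.ext fun x => ?_)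
    change (if j = i then f.1 else ContinuousMap.const X (base Y)) x = _
    split_ifs <;> rfl
  rw [HClass.coord_cls, this]
  split_ifs <;> rfl

theorem cls_power_comp [HGroup Y] (f : PMap x₀ (base Y)) (d : ℕ) :
    ((power Y d).comp f).cls = d • f.cls := by
  induction d with
  | zero => rw [zero_nsmul]; rfl
  | succ n ih =>
    rw [succ_nsmul, ← ih]
    -- `power Y 1` is the identity rather than the product of the constant map with it, so this case
    -- uses the unit law of the group of classes.
    cases n with
    | zero => exact (zero_add f.cls).symm
    | succ n => rfl

theorem HFibre.equivalent_of_coord_eq [HGroup Y] {g g' : PMap x₀ (base (ι → Y))}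
    (h : ∀ i, HClass.coord i g.cls = HClass.coord i g'.cls) :
    PtdHomotopyEquivalent (HFibre.pt g) (HFibre.pt g') :=
  HFibre.equivalent_of_homotopic (PMap.cls_eq_iff.1 (HClass.coord_ext h))

/-- Realises the matrix with rows `(a, b)` and `(c, d)` in coordinates `i` and `j` by a self-map of
the power, prescribing its coordinates as combinations of the projections. -/
theorem exists_mixing [HGroup Y] (i j : ι) (a b c d : ℤ) : ∃ φ : PMap (base (ι → Y)) (base (ι → Y)),
    HClass.coord i φ.cls = a • (coordMap i).cls + b • (coordMap j).cls ∧
    (i ≠ j → HClass.coord j φ.cls = c • (coordMap i).cls + d • (coordMap j).cls) ∧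
    ∀ l, l ≠ i → l ≠ j → HClass.coord l φ.cls = (coordMap l).cls := by
  classical
  obtain ⟨φ, hφ⟩ := exists_coord_eq (x₀ := base (ι → Y)) (Y := Y) (fun l : ι =>
    if l = i then a • (coordMap i).cls + b • (coordMap j).cls else
      if l = j then c • (coordMap i).cls + d • (coordMap j).cls else (coordMap l).cls)
  refine ⟨φ, ?_, fun h => ?_, fun l h h' => ?_⟩
  · rw [hφ, if_pos rfl]
  · rw [hφ, if_neg h.symm, if_pos rfl]
  · rw [hφ, if_neg h, if_neg h']

theorem coord_comp_eq_self [HGroup Y] {φ : PMap (base (ι → Y)) (base (ι → Y))} {l : ι}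
    (h : HClass.coord l φ.cls = (coordMap l).cls) (u : PMap x₀ (base (ι → Y))) :
    HClass.coord l (φ.comp u).cls = HClass.coord l u.cls :=
  congrArg (HClass.precomp u) h

variable [HGroup Y] [HomotopyCommutative Y]

/-- Precomposition with `u` is additive on classes, so a relation between universal coordinates
specialises to the coordinates of `u`. -/
theorem coord_comp_eq {φ : PMap (base (ι → Y)) (base (ι → Y))} {i j l : ι} {a b : ℤ}
    (h : HClass.coord l φ.cls = a • (coordMap i).cls + b • (coordMap j).cls)
    (u : PMap x₀ (base (ι → Y))) : HClass.coord l (φ.comp u).cls =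
      a • HClass.coord i u.cls + b • HClass.coord j u.cls := by
  have := congrArg (HClass.precomp u) h
  rw [map_add, map_zsmul, map_zsmul] at this
  exact this

/-- Composing mixing maps multiplies their matrices, and `h₁` to `h₄` say that the product is the
identity matrix. Collecting terms uses that the group of classes is abelian. -/
theorem mixing_comp_homotopic_id {i j : ι} {a b c d a' b' c' d' : ℤ}
    (h₁ : a' * a + b' * c = 1) (h₂ : a' * b + b' * d = 0) (h₃ : c' * a + d' * c = 0)
    (h₄ : c' * b + d' * d = 1) {φ ψ : PMap (base (ι → Y)) (base (ι → Y))}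
    (hφi : HClass.coord i φ.cls = a • (coordMap i).cls + b • (coordMap j).cls)
    (hφj : HClass.coord j φ.cls = c • (coordMap i).cls + d • (coordMap j).cls)
    (hφ : ∀ l, l ≠ i → l ≠ j → HClass.coord l φ.cls = (coordMap l).cls)
    (hψi : HClass.coord i ψ.cls = a' • (coordMap i).cls + b' • (coordMap j).cls)
    (hψj : HClass.coord j ψ.cls = c' • (coordMap i).cls + d' • (coordMap j).cls)
    (hψ : ∀ l, l ≠ i → l ≠ j → HClass.coord l ψ.cls = (coordMap l).cls) :
    (ψ.comp φ).Homotopic (PMap.id _) := by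
  refine PMap.cls_eq_iff.1 (HClass.coord_ext fun l => ?_)
  have hid : HClass.coord l (PMap.id (base (ι → Y))).cls = (coordMap l).cls := rfl
  rw [hid]
  by_cases hl : l = i
  · subst hl
    rw [coord_comp_eq hψi, hφi, hφj]
    calc _ = (a' * a + b' * c) • (coordMap (Y := Y) l).cls +
          (a' * b + b' * d) • (coordMap (Y := Y) j).cls := by module
      _ = _ := by rw [h₁, h₂, one_zsmul, zero_zsmul, add_zero]
  by_cases hl' : l = j
  · subst hl'
    rw [coord_comp_eq hψj, hφi, hφj]
    calc _ = (c' * a + d' * c) • (coordMap (Y := Y) i).cls +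
          (c' * b + d' * d) • (coordMap (Y := Y) l).cls := by module
      _ = _ := by rw [h₃, h₄, one_zsmul, zero_zsmul, zero_add]
  · rw [coord_comp_eq_self (hψ l hl hl'), hφ l hl hl']

/-- The homotopy fibre is invariant under a unimodular change of two coordinates. -/
theorem HFibre.equivalent_of_det_eq_one {i j : ι} (hij : i ≠ j) {a b c d : ℤ}
    (hdet : a * d - b * c = 1) {g g' : PMap x₀ (base (ι → Y))}
    (hi : HClass.coord i g'.cls = a • HClass.coord i g.cls + b • HClass.coord j g.cls)
    (hj : HClass.coord j g'.cls = c • HClass.coord i g.cls + d • HClass.coord j g.cls)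
    (hne : ∀ l, l ≠ i → l ≠ j → HClass.coord l g'.cls = HClass.coord l g.cls) :
    PtdHomotopyEquivalent (HFibre.pt g) (HFibre.pt g') := by
  obtain ⟨φ, hφi, hφj, hφ⟩ := exists_mixing (Y := Y) i j a b c d
  -- The adjugate matrix, which is the inverse because the determinant is one.
  obtain ⟨ψ, hψi, hψj, hψ⟩ := exists_mixing (Y := Y) i j d (-b) (-c) a
  replace hφj := hφj hij
  replace hψj := hψj hij
  refine (HFibre.equivalent_comp g (φ := φ) (ψ := ψ) ?_ ?_).trans
    (HFibre.equivalent_of_coord_eq fun l => ?_)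
  · exact mixing_comp_homotopic_id (by linear_combination hdet) (by ring) (by ring)
      (by linear_combination hdet) hφi hφj hφ hψi hψj hψ
  · exact mixing_comp_homotopic_id (by linear_combination hdet) (by ring) (by ring)
      (by linear_combination hdet) hψi hψj hψ hφi hφj hφ
  · by_cases hl : l = i
    · subst hl
      rw [coord_comp_eq hφi, hi]
    by_cases hl' : l = j
    · subst hl'
      rw [coord_comp_eq hφj, hj]
    · rw [coord_comp_eq_self (hφ l hl hl'), hne l hl hl']

end Coordinates

/-! ### Euclid's algorithm on the coefficients, and orders -/

section Euclid

variable {X : Type u} {Y : Type v} {ι : Type w} [TopologicalSpace X] [TopologicalSpace Y]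
  [HGroup Y] [HomotopyCommutative Y] {x₀ : X} {f : PMap x₀ (base Y)}

/-- The first row consists of Bézout coefficients, the second of `-q / G` and `p / G` with `G` the
gcd; the determinant is then Bézout's identity divided by `G`. If `G = 0`, the identity matrix
serves. -/
theorem exists_unimodular_gcd (p q : ℤ) : ∃ a b c d : ℤ, a * d - b * c = 1 ∧
    a * p + b * q = Int.gcd p q ∧ c * p + d * q = 0 := by
  by_cases h : (Int.gcd p q : ℤ) = 0
  · obtain ⟨rfl, rfl⟩ := Int.gcd_eq_zero_iff.1 (by exact_mod_cast h)
    exact ⟨1, 0, 0, 1, by simp⟩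
  obtain ⟨p', hp⟩ := Int.gcd_dvd_left p q
  obtain ⟨q', hq⟩ := Int.gcd_dvd_right p q
  have hb := Int.gcd_eq_gcd_ab p q
  refine ⟨Int.gcdA p q, Int.gcdB p q, -q', p', mul_left_cancel₀ h ?_, by linear_combination -hb, ?_⟩
  · linear_combination -Int.gcdA p q * hp - Int.gcdB p q * hq - hb
  · generalize (Int.gcd p q : ℤ) = G at *
    subst hp hq
    ring

/-- Euclid's algorithm on two coordinates. -/
theorem HFibre.exists_equivalent_gcd_pair {i j : ι} (hij : i ≠ j) {k : ι → ℤ}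
    {g : PMap x₀ (base (ι → Y))} (hg : ∀ l, HClass.coord l g.cls = k l • f.cls) :
    ∃ g' : PMap x₀ (base (ι → Y)), PtdHomotopyEquivalent (HFibre.pt g) (HFibre.pt g') ∧
      HClass.coord i g'.cls = (Int.gcd (k i) (k j) : ℤ) • f.cls ∧ HClass.coord j g'.cls = 0 ∧
      ∀ l, l ≠ i → l ≠ j → HClass.coord l g'.cls = k l • f.cls := by
  classical
  obtain ⟨a, b, c, d, hdet, h₁, h₂⟩ := exists_unimodular_gcd (k i) (k j)
  obtain ⟨g', hg'⟩ := exists_coord_eq (fun l => if l = i then (Int.gcd (k i) (k j) : ℤ) • f.cls else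
    if l = j then 0 else k l • f.cls)
  have hi : HClass.coord i g'.cls = (Int.gcd (k i) (k j) : ℤ) • f.cls := by rw [hg', if_pos rfl]
  have hj : HClass.coord j g'.cls = 0 := by rw [hg', if_neg hij.symm, if_pos rfl]
  have hl : ∀ l, l ≠ i → l ≠ j → HClass.coord l g'.cls = k l • f.cls := fun l h h' => by
    rw [hg', if_neg h, if_neg h']
  refine ⟨g', HFibre.equivalent_of_det_eq_one hij hdet ?_ ?_ fun l h h' => ?_, hi, hj, hl⟩
  · rw [hi, hg, hg, ← h₁]
    module
  · rw [hj, hg, hg, smul_smul, smul_smul, ← add_smul, h₂, zero_smul]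
  · rw [hl l h h', hg]

/-- Euclid's algorithm on finitely many coordinates. -/
theorem HFibre.exists_equivalent_gcd {i : ι} (s : Finset ι) (hi : i ∉ s) {k : ι → ℤ}
    {g : PMap x₀ (base (ι → Y))} (hg : ∀ l, HClass.coord l g.cls = k l • f.cls) :
    ∃ (k' : ι → ℤ) (g' : PMap x₀ (base (ι → Y))),
      PtdHomotopyEquivalent (HFibre.pt g) (HFibre.pt g') ∧
      (∀ l, HClass.coord l g'.cls = k' l • f.cls) ∧ (∀ l ∈ s, k' l = 0) ∧
      (∀ l, l ≠ i → l ∉ s → k' l = k l) ∧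
      ∀ c : ℤ, c ∣ k' i ↔ c ∣ k i ∧ ∀ l ∈ s, c ∣ k l := by
  classical
  -- Coordinate `i` accumulates the gcd while those in `s` are cleared one at a time. Recording it
  -- by its divisors avoids fixing its sign, which matters for empty `s`.
  induction s using Finset.induction_on with
  | empty => exact ⟨k, g, .refl _, hg, by simp, by simp, by simp⟩
  | insert j s hj ih =>
    rw [Finset.mem_insert, not_or] at hi
    obtain ⟨k', g', he, hg', h₀, hk', hd⟩ := ih hi.2
    obtain ⟨g'', he', hi', hj', hl'⟩ := HFibre.exists_equivalent_gcd_pair hi.1 hg'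
    refine ⟨fun l => if l = i then (Int.gcd (k' i) (k' j) : ℤ) else if l = j then 0 else k' l, g'',
      he.trans he', fun l => ?_, fun l hl => ?_, fun l hl hl' => ?_, fun c => ?_⟩
    · dsimp only
      split_ifs with h h'
      · rw [h, hi']
      · rw [h', hj', zero_smul]
      · exact hl' l h h'
    · have : l ≠ i := by
        rintro rfl
        exact (Finset.mem_insert.1 hl).elim hi.1 hi.2
      rcases Finset.mem_insert.1 hl with rfl | h
      · simp [this]
      · simp [this, h₀ l h]
    · rw [Finset.mem_insert, not_or] at hl'
      simp only [hl, hl'.1, if_false]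
      exact hk' l hl hl'.2
    · simp only [if_true, Int.dvd_coe_gcd_iff, hd, Finset.forall_mem_insert,
        hk' j (Ne.symm hi.1) hj]
      tauto

/-- The homotopy fibre of a map with coordinates multiples of `f`. -/
theorem HFibre.equivalent_power (n : ℕ) {k : Fin (n + 2) → ℤ}
    {g : PMap x₀ (base (Fin (n + 2) → Y))} (hg : ∀ l, HClass.coord l g.cls = k l • f.cls) :
    PtdHomotopyEquivalent (HFibre.pt g)
      ((HFibre.pt ((power Y (Nat.gcd (addOrderOf f.cls)
        (Finset.univ.gcd fun i => (k i).natAbs))).comp f), fun _ => Path.refl (base Y)) :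
        HFibre ((power Y (Nat.gcd (addOrderOf f.cls)
        (Finset.univ.gcd fun i => (k i).natAbs))).comp f) ×
          (Fin (n + 1) → LoopSpace Y (base Y))) := by
  obtain ⟨k', g', he, hg', h₀, -, hd⟩ := HFibre.exists_equivalent_gcd (i := (0 : Fin (n + 2)))
    (Finset.univ.erase 0) (by simp) hg
  -- Coordinate `1` has been cleared, and `0` is also `m • f` for the order `m` of `f`. Reading it
  -- with coefficient `m` lets a further Euclidean step bring `m` into the gcd. For infinite order
  -- `addOrderOf` is `0`, and the gcd is unaffected.
  have hm : ∀ l, HClass.coord l g'.cls =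
      (if l = 1 then (addOrderOf f.cls : ℤ) else k' l) • f.cls := by
    intro l
    split_ifs with h
    · rw [hg', h₀ l (by simp [h]), zero_smul, natCast_zsmul, addOrderOf_nsmul_eq_zero]
    · exact hg' l
  obtain ⟨g'', he', h0', h1', hl'⟩ :=
    HFibre.exists_equivalent_gcd_pair (zero_ne_one : (0 : Fin (n + 2)) ≠ 1) hm
  have hgcd : Int.gcd (k' 0) (addOrderOf f.cls) =
      Nat.gcd (addOrderOf f.cls) (Finset.univ.gcd fun i => (k i).natAbs) := by
    refine Nat.dvd_left_iff_eq.1 fun c => ?_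
    rw [Nat.dvd_gcd_iff, Finset.dvd_gcd_iff, ← Int.natCast_dvd_natCast, Int.dvd_coe_gcd_iff, hd,
      Int.natCast_dvd_natCast, and_comm]
    simp only [Int.natCast_dvd, Finset.mem_erase, Finset.mem_univ, and_true, true_imp_iff]
    refine and_congr_right fun _ => ⟨fun h l => ?_, fun h => ⟨h 0, fun l _ => h l⟩⟩
    by_cases hl : l = 0
    · rw [hl]
      exact h.1
    · exact h.2 l hl
  refine (he.trans he').trans ((HFibre.equivalent_of_coord_eq fun l => ?_).trans
    (HFibre.equivalent_axis _ (n + 1)))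
  rw [coord_axis, cls_power_comp, ← hgcd]
  split_ifs with h
  · rw [h, h0', if_neg zero_ne_one, if_pos rfl, natCast_zsmul]
  by_cases hl : l = 1
  · rw [hl, h1']
  · rw [hl' l h hl, if_neg hl, h₀ l (by simp [h]), zero_smul]

theorem coord_sum_axis [Fintype ι] [DecidableEq ι] (f : PMap x₀ (base Y)) (k : ι → ℤ) (j : ι) :
    HClass.coord j (∑ i, k i • (axis f i).cls) = k j • f.cls := by
  rw [map_sum, Finset.sum_eq_single j]
  · rw [map_zsmul, coord_axis, if_pos rfl]
  · intro i _ h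
    rw [map_zsmul, coord_axis, if_neg h.symm, smul_zero]
  · simp

/-- Checking coordinates, `n` kills the sum iff `m` divides every `n * k j`, that is, iff `m`
divides `n` times the gcd of the `k j`. This is the condition for `n` to kill that gcd times `f`, so
the two elements have the same order. -/
theorem addOrderOf_sum_axis [Fintype ι] [DecidableEq ι] (k : ι → ℤ)
    (hf : IsOfFinAddOrder f.cls) :
    addOrderOf (∑ i, k i • (axis f i).cls) = addOrderOf f.cls /
      Nat.gcd (addOrderOf f.cls) (Finset.univ.gcd fun i => (k i).natAbs) := by
  rw [← hf.addOrderOf_nsmul, addOrderOf_eq_addOrderOf_iff]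
  intro n
  have h : n • (∑ i, k i • (axis f i).cls) = 0 ↔ ∀ j, addOrderOf f.cls ∣ n * (k j).natAbs := by
    have hj : ∀ j, HClass.coord j (n • ∑ i, k i • (axis f i).cls) = 0 ↔
        addOrderOf f.cls ∣ n * (k j).natAbs := fun j => by
      rw [map_nsmul, coord_sum_axis, ← natCast_zsmul, smul_smul, ← addOrderOf_dvd_iff_zsmul_eq_zero,
        Int.natCast_dvd, Int.natAbs_mul, Int.natAbs_natCast]
    simp only [← hj]
    exact ⟨fun h j => by rw [h, map_zero], fun h => HClass.coord_ext fun j => by rw [h, map_zero]⟩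
  rw [h, smul_smul, mul_comm n, ← addOrderOf_dvd_iff_nsmul_eq_zero, mul_comm,
    ← normalize_eq n, ← Finset.gcd_mul_left, Finset.dvd_gcd_iff]
  simp

theorem exists_eq_sum_of_mem_closure {G : Type*} [AddCommGroup G] [Fintype ι] {a : ι → G} {x : G}
    (hx : x ∈ AddSubgroup.closure (Set.range a)) : ∃ k : ι → ℤ, x = ∑ i, k i • a i := by
  rw [← Submodule.span_int_eq_addSubgroupClosure, Submodule.mem_toAddSubgroup,
    Submodule.mem_span_range_iff_exists_fun] at hx
  obtain ⟨k, hk⟩ := hx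
  exact ⟨k, hk.symm⟩

end Euclid

end PtdHtpy

theorem theorem1p2 {X : Type*} [TopologicalSpace X] (x₀ : X)
    {Y : Type*} [TopologicalSpace Y] [HGroup Y] [HomotopyCommutative Y]
    (f : PMap x₀ (base Y)) (r : ℕ) (hr : 2 ≤ r) :
    (∀ (k : Fin r → ℤ) (g : PMap x₀ (base (Fin r → Y))),
      g.cls = ∑ i, k i • (axis f i).cls →
      let d : ℕ := Nat.gcd (addOrderOf f.cls) (Finset.univ.gcd fun i => (k i).natAbs)
      PtdHomotopyEquivalent (HFibre.pt g)
        ((HFibre.pt ((power Y d).comp f), fun _ => Path.refl (base Y)) :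
          HFibre ((power Y d).comp f) × (Fin (r - 1) → LoopSpace Y (base Y)))) ∧
    (IsOfFinAddOrder f.cls →
      ∀ g g' : PMap x₀ (base (Fin r → Y)),
        g.cls ∈ AddSubgroup.closure (Set.range fun i => (axis f i).cls) →
        g'.cls ∈ AddSubgroup.closure (Set.range fun i => (axis f i).cls) →
        addOrderOf g.cls = addOrderOf g'.cls →
        PtdHomotopyEquivalent (HFibre.pt g) (HFibre.pt g')) := by
  obtain ⟨n, rfl⟩ := Nat.exists_eq_add_of_le' hr
  have main : ∀ (k : Fin (n + 2) → ℤ) (g : PMap x₀ (base (Fin (n + 2) → Y))),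
      g.cls = ∑ i, k i • (axis f i).cls → ∀ l, HClass.coord l g.cls = k l • f.cls :=
    fun k g hg l => hg ▸ coord_sum_axis f k l
  refine ⟨fun k g hg => HFibre.equivalent_power n (main k g hg), fun hf g g' hg hg' ho => ?_⟩
  obtain ⟨k, hk⟩ := exists_eq_sum_of_mem_closure hg
  obtain ⟨k', hk'⟩ := exists_eq_sum_of_mem_closure hg'
  rw [hk, hk', addOrderOf_sum_axis k hf, addOrderOf_sum_axis k' hf] at ho
  have hd : Nat.gcd (addOrderOf f.cls) (Finset.univ.gcd fun i => (k i).natAbs) =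
      Nat.gcd (addOrderOf f.cls) (Finset.univ.gcd fun i => (k' i).natAbs) := by
    -- A divisor `d` of `m` is recovered from `m / d` since `m ≠ 0`; here finiteness of the order is
    -- needed.
    rw [← Nat.div_div_self (Nat.gcd_dvd_left _ _) hf.addOrderOf_pos.ne', ho,
      Nat.div_div_self (Nat.gcd_dvd_left _ _) hf.addOrderOf_pos.ne']
  have e := HFibre.equivalent_power n (main k g hk)
  have e' := HFibre.equivalent_power n (main k' g' hk')
  rw [← hd] at e'
  exact e.trans e'.symm
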